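/- Let $X$ be a real Banach space with dual $X^*$, let $B_{X^*}$ be the closed unit ball of $X^*$, and let $cb(X)$ be the family of all nonempty closed bounded convex subsets of $X$, with the Hausdorff metric $d_H$ and $\|C\|_h=d_H(C,\{0\})=\sup_{x\in C}\|x\|$. For $C\in cb(X)$ and $x^*\in X^*$ put $s(x^*,C)=\sup_{x\in C}\langle x^*,x\rangle$, and let $i:cb(X)\to\ell_\infty(B_{X^*})$, $i(C)=s(\cdot,C)$, be the Rådström embedding. Sums of members of $cb(X)$ are closures of Minkowski sums. The interval $[0,1]$ carries Lebesgue measure $\lambda$ on the $\sigma$-algebra $\mathcal L$ of Lebesgue measurable sets. Let $\Gamma:[0,1]\to cb(X)$ be scalarly measurable, i.e. $t\mapsto s(x^*,\Gamma(t))$ is Lebesgue measurable for every $x^*\in X^*$. Then the following conditions are equivalent: 1. $\Gamma$ is variationally McShane integrable; 2. $i\circ\Gamma\in L_1(\lambda,\ell_\infty(B_{X^*}))$, i.e. $i\circ\Gamma$ is Bochner integrable; 3. $\Gamma$ is Bochner measurable and integrably bounded; 4. $\Gamma$ is Bochner measurable and Pettis integrable, and its Pettis integral has finite variation. Here the notions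 are as follows. - A *tagged partition* of $[0,1]$ is a finite family $(I_k,t_k)_{k\le p}$ of nondegenerate nonoverlapping closed intervals $I_k$ with union $[0,1]$ and points $t_k\in[0,1]$ (not necessarily in $I_k$). It is *$\delta$-fine*, for a gauge $\delta:[0,1]\to(0,\infty)$, if $I_k\subseteq[t_k-\delta(t_k),t_k+\delta(t_k)]$ for all $k$. A set $K\in cb(X)$ is the *McShane integral* of a multifunction $G:[0,1]\to cb(X)$ if for every $\varepsilon>0$ there is a gauge $\delta$ such that $d_H\big(K,\sum_k G(t_k)\lambda(I_k)\big)<\varepsilon$ for every $\delta$-fine tagged partition of $[0,1]$. - $\Gamma$ is *variationally McShane integrable* if for every closed interval $J\subseteq[0,1]$ the multifunction $\Gamma\chi_J$ (equal to $\Gamma$ on $J$ and to $\{0\}$ off $J$) has a McShane integral $\Phi_\Gamma(J)\in cb(X)$, and for every $\varepsilon>0$ there is a gauge $\delta$ such that $\sum_k d_H\big(\Phi_\Gamma(I_k),\Gamma(t_k)\lambda(I_k)\big)<\varepsilon$ for every $\delta$-fine tagged partition of $[0,1]$. - $\Gamma$ is *Bochner measurable* if there are simple multifunctions $\Gamma_n:[0,1]\to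 cb(X)$ (finitely many values, each taken on a set in $\mathcal L$) with $d_H(\Gamma_n(t),\Gamma(t))\to0$ for almost all $t$. It is *integrably bounded* if there is $h\in L_1[0,1]$ with $\|\Gamma(t)\|_h\le|h(t)|$ for almost all $t$. - $\Gamma$ is *Pettis integrable* if $s(x^*,\Gamma(\cdot))$ is Lebesgue integrable for every $x^*\in X^*$ and for every $A\in\mathcal L$ there is $M_\Gamma(A)\in cb(X)$ with $s(x^*,M_\Gamma(A))=\int_A s(x^*,\Gamma)\,d\lambda$ for all $x^*\in X^*$; $M_\Gamma$ is its *Pettis integral*. It has *finite variation* if $\sup\sum_{A\in\pi}\|M_\Gamma(A)\|_h<\infty$, the supremum being over all finite partitions $\pi$ of $[0,1]$ into pairwise disjoint sets of $\mathcal L$. -/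

import Mathlib

open MeasureTheory Set Filter Topology
open scoped unitInterval Pointwise ENNReal

noncomputable section

namespace MultiIntegral

/-- The hyperspace `cb(X)` of all nonempty closed bounded convex subsets of `X`. -/
structure CB (X : Type*) [NormedAddCommGroup X] [NormedSpace ℝ X] where
  carrier : Set X
  nonempty' : carrier.Nonempty
  isClosed' : IsClosed carrier
  isBounded' : Bornology.IsBounded carrier
  convex' : Convex ℝ carrier

variable {X : Type*} [NormedAddCommGroup X] [NormedSpace ℝ X]

instance : CoeOut (CB X) (Set X) := ⟨CB.carrier⟩

/-- The singleton `{0}`, as an element of `cb(X)`. -/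
instance : Zero (CB X) :=
  ⟨⟨{0}, singleton_nonempty 0, isClosed_singleton, Bornology.isBounded_singleton,
    convex_singleton 0⟩⟩

/-- The norm `‖C‖_h`, the Hausdorff distance from `C` to `{0}`, i.e. `sup {‖x‖ : x ∈ C}`. -/
def hnorm (C : CB X) : ℝ := Metric.hausdorffDist (C : Set X) {0}

/-- The support function `s(x*, C) = sup {⟨x*, x⟩ : x ∈ C}`. -/
def supp (f : StrongDual ℝ X) (C : CB X) : ℝ := sSup ((fun x => f x) '' (C : Set X))

theorem abs_supp_le (C : CB X) {R : ℝ} (hR : ∀ x ∈ (C : Set X), ‖x‖ ≤ R)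
    (f : StrongDual ℝ X) : |supp f C| ≤ ‖f‖ * R := by
  have h : ∀ x ∈ (C : Set X), |f x| ≤ ‖f‖ * R := fun x hx =>
    (f.le_opNorm x).trans (mul_le_mul_of_nonneg_left (hR x hx) (norm_nonneg f))
  have hbdd : BddAbove ((fun x => f x) '' (C : Set X)) := by
    refine ⟨‖f‖ * R, ?_⟩
    rintro _ ⟨x, hx, rfl⟩
    exact (abs_le.1 (h x hx)).2
  obtain ⟨x₀, hx₀⟩ := C.nonempty'
  refine abs_le.2 ⟨(abs_le.1 (h x₀ hx₀)).1.trans (le_csSup hbdd ⟨x₀, hx₀, rfl⟩), ?_⟩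
  refine csSup_le ⟨_, x₀, hx₀, rfl⟩ ?_
  rintro _ ⟨x, hx, rfl⟩
  exact (abs_le.1 (h x hx)).2

/-- `ℓ_∞(B_{X*})`: bounded real functions on the closed unit ball of the dual, with the
supremum norm. -/
abbrev LInftyDualBall (X : Type*) [NormedAddCommGroup X] [NormedSpace ℝ X] : Type _ :=
  lp (fun _ : Metric.closedBall (0 : StrongDual ℝ X) 1 => ℝ) ∞

theorem memℓp_supp (C : CB X) :
    Memℓp (fun f : Metric.closedBall (0 : StrongDual ℝ X) 1 => supp (f : StrongDual ℝ X) C) ∞ := by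
  obtain ⟨R, hR⟩ := C.isBounded'.exists_norm_le
  have hR0 : 0 ≤ R := by
    obtain ⟨x, hx⟩ := C.nonempty'
    exact (norm_nonneg x).trans (hR x hx)
  refine memℓp_infty ⟨R, ?_⟩
  rintro _ ⟨f, rfl⟩
  have hf : ‖(f : StrongDual ℝ X)‖ ≤ 1 := mem_closedBall_zero_iff.1 f.2
  exact (abs_supp_le C hR f).trans (mul_le_of_le_one_left hR0 hf)

/-- The Rådström embedding `i : cb(X) → ℓ_∞(B_{X*})`, `i(C) = s(·, C)`. -/
def radstrom (C : CB X) : LInftyDualBall X :=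
  ⟨fun f => supp (f : StrongDual ℝ X) C, memℓp_supp C⟩

/-! Measurability of multifunctions on `[0,1]`. Lebesgue measurable sets are the null measurable
sets of `volume`, and Lebesgue measurable functions are the a.e. measurable ones. -/

/-- Every `s(x*, Γ(·))` is Lebesgue measurable. -/
def ScalarlyMeasurable (Γ : I → CB X) : Prop :=
  ∀ f : StrongDual ℝ X, AEMeasurable (fun t => supp f (Γ t)) volume

/-- Every `s(x*, Γ(·))` is Lebesgue integrable. -/
def ScalarlyIntegrable (Γ : I → CB X) : Prop :=
  ∀ f : StrongDual ℝ X, Integrable (fun t => supp f (Γ t)) volume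

/-- `G` takes finitely many values, each of them on a Lebesgue measurable set. -/
def IsSimple (G : I → CB X) : Prop :=
  (range G).Finite ∧ ∀ C : CB X, NullMeasurableSet (G ⁻¹' {C}) volume

/-- `Γ` is almost everywhere the limit, in the Hausdorff distance, of simple multifunctions. -/
def BochnerMeasurable (Γ : I → CB X) : Prop :=
  ∃ G : ℕ → I → CB X, (∀ n, IsSimple (G n)) ∧
    ∀ᵐ t : I, Tendsto (fun n => Metric.hausdorffDist (G n t : Set X) (Γ t : Set X)) atTop (𝓝 0)

/-- `‖Γ(t)‖_h ≤ |h(t)|` for almost all `t`, for some `h ∈ L_1[0,1]`. -/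
def IntegrablyBounded (Γ : I → CB X) : Prop :=
  ∃ h : I → ℝ, Integrable h volume ∧ ∀ᵐ t : I, hnorm (Γ t) ≤ |h t|

/-- `M` is the (indefinite) Pettis integral of `Γ`; only its values at Lebesgue measurable sets
matter. -/
def IsPettisIntegral (Γ : I → CB X) (M : Set I → CB X) : Prop :=
  ScalarlyIntegrable Γ ∧ ∀ A : Set I, NullMeasurableSet A volume →
    ∀ f : StrongDual ℝ X, supp f (M A) = ∫ t in A, supp f (Γ t)

/-- `P` is a partition of `E` into finitely many pairwise disjoint Lebesgue measurable sets. -/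
def IsMeasurablePartition (P : Finset (Set I)) (E : Set I) : Prop :=
  (∀ A ∈ P, NullMeasurableSet A volume) ∧ (P : Set (Set I)).PairwiseDisjoint id ∧
    ⋃₀ (P : Set (Set I)) = E

/-- The variation `|M|(E)`, the supremum of `∑_{A ∈ P} ‖M(A)‖_h` over the partitions `P`
of `E`. -/
def variation (M : Set I → CB X) (E : Set I) : ℝ≥0∞ :=
  ⨆ (P : Finset (Set I)) (_ : IsMeasurablePartition P E), ∑ A ∈ P, ENNReal.ofReal (hnorm (M A))

/-! The McShane and variational McShane integrals. A closed subinterval `[a, b]` of `[0,1]` is an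
element of `NonemptyInterval I`. -/

/-- A tagged partition of `[0,1]` into finitely many nondegenerate nonoverlapping closed
intervals; the tag of an interval is any point of `[0,1]`, not necessarily in the interval. -/
structure McShanePartition where
  n : ℕ
  interval : Fin n → NonemptyInterval I
  tag : Fin n → I
  nondegenerate : ∀ k, (interval k).fst < (interval k).snd
  nonoverlapping : Pairwise fun j k =>
    Disjoint (Ioo (interval j).fst (interval j).snd) (Ioo (interval k).fst (interval k).snd)
  cover : ⋃ k, Icc (interval k).fst (interval k).snd = univ

/-- The length of an interval. -/
def len (J : NonemptyInterval I) : ℝ := (J.snd : ℝ) - (J.fst : ℝ)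

/-- `J_k ⊆ [t_k - δ(t_k), t_k + δ(t_k)]` for every `k`. -/
def McShanePartition.IsFine (P : McShanePartition) (δ : I → ℝ) : Prop :=
  ∀ k, Icc (P.interval k).fst (P.interval k).snd ⊆ Metric.closedBall (P.tag k) (δ (P.tag k))

/-- The Riemann sum `∑ Γ(t_k) λ(J_k)` in `cb(X)`: the closure of the Minkowski sum. -/
def McShanePartition.riemannSum (P : McShanePartition) (Γ : I → CB X) : Set X :=
  closure (∑ k, len (P.interval k) • (Γ (P.tag k) : Set X))

/-- `K` is the McShane integral of `Γ` on `[0,1]`. -/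
def IsMcShaneIntegral (Γ : I → CB X) (K : CB X) : Prop :=
  ∀ ε > (0 : ℝ), ∃ δ : I → ℝ, (∀ t, 0 < δ t) ∧
    ∀ P : McShanePartition, P.IsFine δ →
      Metric.hausdorffDist (K : Set X) (P.riemannSum Γ) < ε

/-- `Γ` is variationally McShane integrable. Here `Φ(J)` is the McShane integral of `Γ χ_J`,
where `Γ χ_J` is `Γ` on `J` and `{0}` off `J`. -/
def VariationallyMcShaneIntegrable (Γ : I → CB X) : Prop :=
  ∃ Φ : NonemptyInterval I → CB X,
    (∀ J, IsMcShaneIntegral ((Icc J.fst J.snd).indicator Γ) (Φ J)) ∧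
    ∀ ε > (0 : ℝ), ∃ δ : I → ℝ, (∀ t, 0 < δ t) ∧
      ∀ P : McShanePartition, P.IsFine δ →
        ∑ k, Metric.hausdorffDist (Φ (P.interval k) : Set X)
          (len (P.interval k) • (Γ (P.tag k) : Set X)) < ε

end MultiIntegral

end

noncomputable section

namespace MultiIntegral

variable {X : Type*} [NormedAddCommGroup X] [NormedSpace ℝ X]

/-! Everything is transferred to the Banach-space-valued function `f = i ∘ Γ`, and Bochner
integrability of `f` is the hub. By Hahn–Banach, `i` is isometric for the Hausdorff distance
(`norm_radstrom_sub`). It carries closed Minkowski combinations with nonnegative coefficients to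
linear combinations, and for complete `X` its range is closed and convex. Hence Riemann sums become
ordinary sums, and Bochner integrals of `f` are again images of members of `cb(X)`.

Bochner measurability of `Γ` is strong measurability of `f`, and `‖f t‖ = ‖Γ(t)‖_h`, which gives 2 ↔
3. For 4 → 2, `f` is almost constant on the pieces of a countable partition, so `∫ ‖f‖` over a piece
is at most the norm of the Pettis integral there plus a multiple of the measure; finite variation
makes the sum converge.

For 2 → 1, a Bochner integrable `f` is approximated in `L¹` by a continuous function, and a lower
semicontinuous majorant of the error controls it at tags lying outside their intervals
(`exists_gauge_sum_setIntegral_norm_sub_lt`).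

For 1 → 2, let `F` be the primitive. A stopping argument on dyadic cells shows that the means of `F`
converge to `f` almost everywhere. This makes `f` strongly measurable, and the means are bounded in
`L¹`, so Fatou's lemma gives integrability. -/

/-- Nonempty, bounded and convex sets: those whose closures are the members of `cb(X)`. -/
structure IsConvexBody (S : Set X) : Prop where
  nonempty : S.Nonempty
  isBounded : Bornology.IsBounded S
  convex : Convex ℝ S

namespace CB

theorem isConvexBody (C : CB X) : IsConvexBody (C : Set X) :=
  ⟨C.nonempty', C.isBounded', C.convex'⟩

/-- The member of `cb(X)` which is the closure of a nonempty bounded convex set. -/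
def ofClosure (S : Set X) (hS : IsConvexBody S) : CB X where
  carrier := closure S
  nonempty' := hS.nonempty.closure
  isClosed' := isClosed_closure
  isBounded' := hS.isBounded.closure
  convex' := hS.convex.closure

end CB

/-! ### Support functions and the Hausdorff distance. -/

/-- The support function of an arbitrary set. -/
def setSupp (f : StrongDual ℝ X) (S : Set X) : ℝ := sSup (f '' S)

theorem supp_eq_setSupp (f : StrongDual ℝ X) (C : CB X) : supp f C = setSupp f (C : Set X) := rfl

theorem bddAbove_image_of_isBounded (f : StrongDual ℝ X) {S : Set X}
    (hS : Bornology.IsBounded S) : BddAbove (f '' S) :=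
  (f.lipschitz.isBounded_image hS).bddAbove

namespace IsConvexBody

variable {S T : Set X}

theorem le_setSupp (hS : IsConvexBody S) (f : StrongDual ℝ X) {x : X} (hx : x ∈ S) :
    f x ≤ setSupp f S :=
  le_csSup (bddAbove_image_of_isBounded f hS.isBounded) (mem_image_of_mem f hx)

theorem setSupp_le (hS : IsConvexBody S) {f : StrongDual ℝ X} {r : ℝ} (h : ∀ x ∈ S, f x ≤ r) :
    setSupp f S ≤ r :=
  csSup_le (hS.nonempty.image f) (by rintro _ ⟨x, hx, rfl⟩; exact h x hx)

theorem hausdorffEDist_ne_top (hS : IsConvexBody S) (hT : IsConvexBody T) :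
    Metric.hausdorffEDist S T ≠ ⊤ :=
  Metric.hausdorffEDist_ne_top_of_nonempty_of_bounded hS.nonempty hT.nonempty hS.isBounded
    hT.isBounded

theorem setSupp_sub_le (hS : IsConvexBody S) (hT : IsConvexBody T) (f : StrongDual ℝ X) :
    setSupp f S - setSupp f T ≤ ‖f‖ * Metric.hausdorffDist S T := by
  rw [sub_le_iff_le_add]
  refine hS.setSupp_le fun x hx => ?_
  have key : ∀ r > Metric.hausdorffDist S T, f x ≤ ‖f‖ * r + setSupp f T := by
    intro r hr
    obtain ⟨y, hy, hxy⟩ :=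
      Metric.exists_dist_lt_of_hausdorffDist_lt hx hr (hS.hausdorffEDist_ne_top hT)
    have h1 : f (x - y) ≤ ‖f‖ * r :=
      (le_abs_self _).trans ((f.le_opNorm _).trans
        (mul_le_mul_of_nonneg_left (by rw [← dist_eq_norm]; exact hxy.le) (norm_nonneg f)))
    have h2 := hT.le_setSupp f hy
    rw [map_sub] at h1
    linarith
  have hlim : Tendsto (fun r : ℝ => ‖f‖ * r + setSupp f T)
      (𝓝[>] Metric.hausdorffDist S T) (𝓝 (‖f‖ * Metric.hausdorffDist S T + setSupp f T)) :=
    (Continuous.tendsto (by fun_prop) _).mono_left nhdsWithin_le_nhds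
  exact ge_of_tendsto hlim (by filter_upwards [self_mem_nhdsWithin] with r hr using key r hr)

theorem abs_setSupp_sub_le (hS : IsConvexBody S) (hT : IsConvexBody T) (f : StrongDual ℝ X) :
    |setSupp f S - setSupp f T| ≤ ‖f‖ * Metric.hausdorffDist S T := by
  refine abs_sub_le_iff.2 ⟨hS.setSupp_sub_le hT f, ?_⟩
  rw [Metric.hausdorffDist_comm]
  exact hT.setSupp_sub_le hS f

/-- If `x` were farther than `r' > r` from `T`, Hahn–Banach would separate `ball x r'` from `T`, and
the normalised separating functional would see a gap of at least `r'` between `S` and `T`. -/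
theorem infDist_le_of_setSupp (hS : IsConvexBody S) (hT : IsConvexBody T) {r : ℝ} (hr : 0 ≤ r)
    (h : ∀ f : StrongDual ℝ X, ‖f‖ ≤ 1 → setSupp f S - setSupp f T ≤ r) {x : X} (hx : x ∈ S) :
    Metric.infDist x T ≤ r := by
  by_contra! hlt
  obtain ⟨r', hr', hlt'⟩ := exists_between hlt
  have hr'0 : 0 < r' := hr.trans_lt hr'
  have hdisj : Disjoint (Metric.ball x r') T := by
    refine Set.disjoint_left.2 fun y hy hyT => ?_
    have := Metric.infDist_le_dist_of_mem (x := x) hyT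
    rw [Metric.mem_ball, dist_comm] at hy
    linarith
  obtain ⟨g, u, hg, hu⟩ :=
    geometric_hahn_banach_open (convex_ball x r') Metric.isOpen_ball hT.convex hdisj
  obtain ⟨b, hb⟩ := hT.nonempty
  have hgx : g x < u := hg x (Metric.mem_ball_self hr'0)
  -- Since `g < u` on the whole ball, letting points tend to its boundary gives `g x + r' * ‖g‖ ≤
  -- u`.
  have hbound : ‖g‖ ≤ (u - g x) / r' := by
    refine g.opNorm_le_bound (div_nonneg (by linarith) hr'0.le) fun z => ?_
    have key : ∀ w : X, g w ≤ (u - g x) / r' * ‖w‖ := by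
      intro w
      rcases eq_or_ne w 0 with rfl | hw
      · simp
      have hwn : 0 < ‖w‖ := norm_pos_iff.2 hw
      have hc : ∀ c : ℝ, 0 < c → c < r' / ‖w‖ → c * g w ≤ u - g x := by
        intro c hc0 hc
        have : x + c • w ∈ Metric.ball x r' := by
          rw [mem_ball_iff_norm, add_sub_cancel_left, norm_smul, Real.norm_of_nonneg hc0.le]
          exact (lt_div_iff₀ hwn).1 hc
        have := hg _ this
        rw [map_add, map_smul, smul_eq_mul] at this
        linarith
      have hlim : Tendsto (fun c : ℝ => c * g w) (𝓝[<] (r' / ‖w‖)) (𝓝 (r' / ‖w‖ * g w)) :=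
        (Continuous.tendsto (by fun_prop) _).mono_left nhdsWithin_le_nhds
      have hpos : 0 < r' / ‖w‖ := div_pos hr'0 hwn
      have := le_of_tendsto hlim (by
        filter_upwards [Ioo_mem_nhdsLT hpos] with c hc' using hc c hc'.1 hc'.2)
      rw [div_mul_eq_mul_div, div_le_iff₀ hwn] at this
      rw [div_mul_eq_mul_div, le_div_iff₀ hr'0]
      linarith
    refine abs_le.2 ⟨?_, key z⟩
    have := key (-z)
    rw [map_neg, norm_neg] at this
    linarith
  have hg0 : 0 < ‖g‖ := by
    refine norm_pos_iff.2 fun h0 => ?_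
    have := hu b hb
    simp only [h0, zero_apply] at this hgx
    linarith
  rw [le_div_iff₀ hr'0] at hbound
  -- The sign is reversed because `g` is smaller at `x` than on `T`, while the hypothesis bounds the
  -- excess of `S` over `T`.
  have hn : ‖-(‖g‖⁻¹ • g)‖ ≤ 1 := by
    rw [norm_neg, norm_smul, norm_inv, norm_norm, inv_mul_cancel₀ hg0.ne']
  have h1 := hS.le_setSupp (-(‖g‖⁻¹ • g)) hx
  have h2 : setSupp (-(‖g‖⁻¹ • g)) T ≤ ‖g‖⁻¹ * (-(g x) - ‖g‖ * r') := by
    refine hT.setSupp_le fun y hy => ?_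
    have := hu y hy
    simp only [neg_apply, smul_apply, smul_eq_mul]
    rw [← mul_neg]
    exact mul_le_mul_of_nonneg_left (by linarith) (inv_nonneg.2 hg0.le)
  have h3 := h _ hn
  have h4 : ‖g‖⁻¹ * (-(g x) - ‖g‖ * r') = -(‖g‖⁻¹ * g x) - r' := by
    field_simp
  simp only [neg_apply, smul_apply, smul_eq_mul] at h1
  linarith

/-- Hörmander's formula. -/
theorem hausdorffDist_le_of_setSupp (hS : IsConvexBody S) (hT : IsConvexBody T) {r : ℝ}
    (hr : 0 ≤ r) (h : ∀ f : StrongDual ℝ X, ‖f‖ ≤ 1 → |setSupp f S - setSupp f T| ≤ r) :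
    Metric.hausdorffDist S T ≤ r :=
  Metric.hausdorffDist_le_of_infDist hr
    (fun _ hx => hS.infDist_le_of_setSupp hT hr
      (fun f hf => (abs_sub_le_iff.1 (h f hf)).1) hx)
    (fun _ hx => hT.infDist_le_of_setSupp hS hr
      (fun f hf => (abs_sub_le_iff.1 (h f hf)).2) hx)

/-- A set and its closure are at Hausdorff distance zero, and support functions are Lipschitz for
that distance. -/
theorem setSupp_closure (hS : IsConvexBody S) (f : StrongDual ℝ X) :
    setSupp f (closure S) = setSupp f S := by
  have h := (CB.ofClosure S hS).isConvexBody.abs_setSupp_sub_le hS f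
  have h0 : Metric.hausdorffDist ((CB.ofClosure S hS : CB X) : Set X) S = 0 := by
    change Metric.hausdorffDist (closure S) S = 0
    rw [Metric.hausdorffDist_closure₁, Metric.hausdorffDist_self_zero]
  rw [h0, mul_zero] at h
  exact sub_eq_zero.1 (abs_nonpos_iff.1 h)

theorem zero : IsConvexBody (0 : Set X) :=
  ⟨zero_nonempty, Bornology.isBounded_singleton, convex_singleton 0⟩

theorem add (hS : IsConvexBody S) (hT : IsConvexBody T) : IsConvexBody (S + T) :=
  ⟨hS.nonempty.add hT.nonempty, hS.isBounded.add hT.isBounded, hS.convex.add hT.convex⟩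

theorem smul (hS : IsConvexBody S) (c : ℝ) : IsConvexBody (c • S) :=
  ⟨hS.nonempty.smul_set, hS.isBounded.smul₀ c, hS.convex.smul c⟩

theorem sum {ι : Type*} (s : Finset ι) {A : ι → Set X} (hA : ∀ k, IsConvexBody (A k)) :
    IsConvexBody (∑ k ∈ s, A k) := by
  classical
  induction s using Finset.induction_on with
  | empty => simpa using zero
  | insert k s hk ih => rw [Finset.sum_insert hk]; exact (hA k).add ih

theorem setSupp_add (hS : IsConvexBody S) (hT : IsConvexBody T) (f : StrongDual ℝ X) :
    setSupp f (S + T) = setSupp f S + setSupp f T := by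
  rw [setSupp, image_add, csSup_add (hS.nonempty.image f)
    (bddAbove_image_of_isBounded f hS.isBounded) (hT.nonempty.image f)
    (bddAbove_image_of_isBounded f hT.isBounded)]
  rfl

end IsConvexBody

theorem setSupp_smul (f : StrongDual ℝ X) {c : ℝ} (hc : 0 ≤ c) (S : Set X) :
    setSupp f (c • S) = c * setSupp f S := by
  rw [setSupp, image_smul_set, Real.sSup_smul_of_nonneg hc]
  rfl

theorem setSupp_zero (f : StrongDual ℝ X) : setSupp f (0 : Set X) = 0 := by
  change sSup (f '' {0}) = 0
  simp

theorem IsConvexBody.setSupp_sum {ι : Type*} (s : Finset ι) {A : ι → Set X}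
    (hA : ∀ k, IsConvexBody (A k)) (f : StrongDual ℝ X) :
    setSupp f (∑ k ∈ s, A k) = ∑ k ∈ s, setSupp f (A k) := by
  classical
  induction s using Finset.induction_on with
  | empty => simpa using setSupp_zero f
  | insert k s hk ih =>
    rw [Finset.sum_insert hk, Finset.sum_insert hk, (hA k).setSupp_add (IsConvexBody.sum s hA), ih]

theorem supp_smul (f : StrongDual ℝ X) {c : ℝ} (hc : 0 ≤ c) (C : CB X) :
    supp (c • f) C = c * supp f C := by
  have : (fun x => (c • f) x) '' (C : Set X) = c • (f '' (C : Set X)) := by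
    rw [← image_smul, image_image]
    rfl
  rw [supp, this, Real.sSup_smul_of_nonneg hc]
  rfl

/-! The Rådström embedding. -/

theorem radstrom_apply (C : CB X) (f : Metric.closedBall (0 : StrongDual ℝ X) 1) :
    radstrom C f = supp (f : StrongDual ℝ X) C := rfl

theorem norm_radstrom_sub (C D : CB X) :
    ‖radstrom C - radstrom D‖ = Metric.hausdorffDist (C : Set X) (D : Set X) := by
  refine le_antisymm ?_ ?_
  · refine lp.norm_le_of_forall_le Metric.hausdorffDist_nonneg fun f => ?_
    have hf : ‖(f : StrongDual ℝ X)‖ ≤ 1 := mem_closedBall_zero_iff.1 f.2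
    exact (C.isConvexBody.abs_setSupp_sub_le D.isConvexBody f).trans
      (mul_le_of_le_one_left Metric.hausdorffDist_nonneg hf)
  · refine C.isConvexBody.hausdorffDist_le_of_setSupp D.isConvexBody (norm_nonneg _)
      fun f hf => ?_
    exact lp.norm_apply_le_norm ENNReal.top_ne_zero (radstrom C - radstrom D)
      ⟨f, mem_closedBall_zero_iff.2 hf⟩

theorem radstrom_zero : radstrom (0 : CB X) = 0 := by
  ext f
  exact setSupp_zero (f : StrongDual ℝ X)

theorem norm_radstrom (C : CB X) : ‖radstrom C‖ = hnorm C := by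
  rw [← sub_zero (radstrom C), ← radstrom_zero, norm_radstrom_sub]
  rfl

theorem radstrom_ofClosure_sum_smul {ι : Type*} (s : Finset ι) {c : ι → ℝ} (hc : ∀ k, 0 ≤ c k)
    (A : ι → CB X) :
    radstrom (CB.ofClosure (∑ k ∈ s, c k • (A k : Set X))
      (IsConvexBody.sum s fun k => (A k).isConvexBody.smul (c k))) =
      ∑ k ∈ s, c k • radstrom (A k) := by
  ext f
  have hb : ∀ k, IsConvexBody (c k • (A k : Set X)) := fun k => (A k).isConvexBody.smul (c k)
  rw [radstrom_apply, supp_eq_setSupp]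
  refine ((IsConvexBody.sum s hb).setSupp_closure _).trans ?_
  rw [IsConvexBody.setSupp_sum s hb, lp.coeFn_sum, Finset.sum_apply]
  exact Finset.sum_congr rfl fun k _ => setSupp_smul _ (hc k) _

theorem hausdorffDist_closure_sum_smul {ι : Type*} (s : Finset ι) {c : ι → ℝ}
    (hc : ∀ k, 0 ≤ c k) (A : ι → CB X) (K : CB X) :
    Metric.hausdorffDist (K : Set X) (closure (∑ k ∈ s, c k • (A k : Set X))) =
      ‖radstrom K - ∑ k ∈ s, c k • radstrom (A k)‖ := by
  rw [← radstrom_ofClosure_sum_smul s hc, norm_radstrom_sub]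
  rfl

theorem hausdorffDist_smul {c : ℝ} (hc : 0 ≤ c) (A K : CB X) :
    Metric.hausdorffDist (K : Set X) (c • (A : Set X)) = ‖radstrom K - c • radstrom A‖ := by
  have := hausdorffDist_closure_sum_smul {()} (c := fun _ => c) (fun _ => hc) (fun _ => A) K
  simpa [Metric.hausdorffDist_closure₂] using this

theorem convex_range_radstrom : Convex ℝ (range (radstrom : CB X → LInftyDualBall X)) := by
  rintro _ ⟨C, rfl⟩ _ ⟨D, rfl⟩ a b ha hb -
  refine ⟨_, (radstrom_ofClosure_sum_smul Finset.univ (c := ![a, b]) (fun k => ?_) ![C, D]).trans ?_⟩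
  · fin_cases k
    exacts [ha, hb]
  · simp [Fin.sum_univ_two]

/-- The isometry turns a convergent sequence of images into a Cauchy sequence in the complete
hyperspace of closed sets. Its limit inherits nonemptiness, boundedness and convexity by
approximation. -/
theorem isClosed_range_radstrom [CompleteSpace X] :
    IsClosed (range (radstrom : CB X → LInftyDualBall X)) := by
  refine isClosed_of_closure_subset fun φ hφ => ?_
  obtain ⟨y, hy, hlim⟩ := mem_closure_iff_seq_limit.1 hφ
  choose C hC using hy
  let K : ℕ → TopologicalSpace.Closeds X := fun n => ⟨(C n : Set X), (C n).isClosed'⟩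
  have hedist : ∀ m n, edist (K m) (K n) = edist (y m) (y n) := by
    intro m n
    rw [TopologicalSpace.Closeds.edist_eq, edist_dist (y m), dist_eq_norm, ← hC, ← hC,
      norm_radstrom_sub, Metric.hausdorffDist, ENNReal.ofReal_toReal
        ((C m).isConvexBody.hausdorffEDist_ne_top (C n).isConvexBody)]
    rfl
  have hcauchy : CauchySeq K := by
    have := hlim.cauchySeq
    rw [EMetric.cauchySeq_iff] at this ⊢
    simpa only [hedist] using this
  obtain ⟨L, hL⟩ := cauchySeq_tendsto_of_complete hcauchy
  have hL' : Tendsto (fun n => Metric.hausdorffEDist (C n : Set X) (L : Set X)) atTop (𝓝 0) := by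
    have := tendsto_iff_edist_tendsto_0.1 hL
    simp only [TopologicalSpace.Closeds.edist_eq] at this
    exact this
  have hnear : ∀ ε : ℝ, 0 < ε → ∃ n, Metric.hausdorffEDist (C n : Set X) (L : Set X) <
      ENNReal.ofReal ε := fun ε hε =>
    (hL'.eventually_lt_const (ENNReal.ofReal_pos.2 hε)).exists
  have hto : ∀ {n : ℕ} {ε : ℝ},
      Metric.hausdorffEDist (C n : Set X) (L : Set X) < ENNReal.ofReal ε →
      ∀ x ∈ (C n : Set X), ∃ y ∈ (L : Set X), dist x y < ε := by
    intro n ε h x hx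
    obtain ⟨y, hy, hxy⟩ := Metric.exists_edist_lt_of_hausdorffEDist_lt hx h
    exact ⟨y, hy, edist_lt_ofReal.1 hxy⟩
  have hfrom : ∀ {n : ℕ} {ε : ℝ},
      Metric.hausdorffEDist (C n : Set X) (L : Set X) < ENNReal.ofReal ε →
      ∀ x ∈ (L : Set X), ∃ y ∈ (C n : Set X), dist x y < ε := by
    intro n ε h x hx
    rw [Metric.hausdorffEDist_comm] at h
    obtain ⟨y, hy, hxy⟩ := Metric.exists_edist_lt_of_hausdorffEDist_lt hx h
    exact ⟨y, hy, edist_lt_ofReal.1 hxy⟩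
  obtain ⟨N, hN⟩ := hnear 1 one_pos
  have hLne : (L : Set X).Nonempty := by
    obtain ⟨x, hx⟩ := (C N).nonempty'
    obtain ⟨y, hy, -⟩ := hto hN x hx
    exact ⟨y, hy⟩
  have hLbdd : Bornology.IsBounded (L : Set X) := by
    obtain ⟨R, hR⟩ := (C N).isBounded'.exists_norm_le
    refine isBounded_iff_forall_norm_le.2 ⟨R + 1, fun x hx => ?_⟩
    obtain ⟨y, hy, hxy⟩ := hfrom hN x hx
    have h1 := norm_le_norm_add_norm_sub' x y
    rw [← dist_eq_norm] at h1
    linarith [hR y hy]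
  have hLconv : Convex ℝ (L : Set X) := by
    intro x hx y hy a b ha hb hab
    rw [← L.isClosed.closure_eq, Metric.mem_closure_iff]
    intro ε hε
    obtain ⟨n, hn⟩ := hnear (ε / 2) (half_pos hε)
    obtain ⟨x', hx', hxx⟩ := hfrom hn x hx
    obtain ⟨y', hy', hyy⟩ := hfrom hn y hy
    obtain ⟨w, hw, hzw⟩ := hto hn _ ((C n).convex' hx' hy' ha hb hab)
    refine ⟨w, hw, (dist_triangle _ (a • x' + b • y') _).trans_lt ?_⟩
    have h1 : dist (a • x + b • y) (a • x' + b • y') ≤ a * dist x x' + b * dist y y' := by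
      refine (dist_add_add_le _ _ _ _).trans (le_of_eq ?_)
      rw [dist_smul₀, dist_smul₀, Real.norm_of_nonneg ha, Real.norm_of_nonneg hb]
    have h2 : a * dist x x' + b * dist y y' ≤ a * (ε / 2) + b * (ε / 2) := by gcongr
    have h3 : a * (ε / 2) + b * (ε / 2) = ε / 2 := by rw [← add_mul, hab, one_mul]
    linarith
  let D : CB X := ⟨L, hLne, L.isClosed, hLbdd, hLconv⟩
  refine ⟨D, tendsto_nhds_unique ?_ hlim⟩
  rw [tendsto_iff_dist_tendsto_zero]
  have : ∀ n, dist (y n) (radstrom D) = (Metric.hausdorffEDist (C n : Set X) (L : Set X)).toReal := by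
    intro n
    rw [dist_eq_norm, ← hC, norm_radstrom_sub]
    rfl
  simp only [this]
  exact (ENNReal.tendsto_toReal ENNReal.zero_ne_top).comp hL'

/-! Bochner measurability and integrable boundedness. -/

theorem IsSimple.aestronglyMeasurable {G : I → CB X} (hG : IsSimple G) :
    AEStronglyMeasurable (fun t => radstrom (G t)) (volume : Measure I) := by
  classical
  have h : (fun t => radstrom (G t)) = fun t => ∑ C ∈ hG.1.toFinset,
      (G ⁻¹' {C}).indicator (fun _ => radstrom C) t := by
    funext t
    rw [Finset.sum_eq_single (G t)]
    · simp
    · intro C _ hC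
      exact indicator_of_notMem (fun h => hC (Eq.symm h)) _
    · simp
  rw [h]
  exact Finset.aestronglyMeasurable_fun_sum _ fun C _ =>
    aestronglyMeasurable_const.indicator₀ (hG.2 C)

theorem BochnerMeasurable.aestronglyMeasurable {Γ : I → CB X} (h : BochnerMeasurable Γ) :
    AEStronglyMeasurable (fun t => radstrom (Γ t)) (volume : Measure I) := by
  obtain ⟨G, hG, hlim⟩ := h
  refine aestronglyMeasurable_of_tendsto_ae atTop (fun n => (hG n).aestronglyMeasurable) ?_
  filter_upwards [hlim] with t ht
  rw [tendsto_iff_dist_tendsto_zero]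
  simpa only [dist_eq_norm, norm_radstrom_sub] using ht

/-- Simple approximants in `ℓ_∞` must come from simple multifunctions, so their values are chosen in
a separable part `R` of the range of `i` and then pulled back. -/
theorem bochnerMeasurable_of_aestronglyMeasurable {Γ : I → CB X}
    (h : AEStronglyMeasurable (fun t => radstrom (Γ t)) (volume : Measure I)) :
    BochnerMeasurable Γ := by
  borelize (LInftyDualBall X)
  obtain ⟨s, hs, hmem⟩ := h.isSeparable_ae_range
  -- The point `radstrom 0` is the base value which `SimpleFunc.approxOn` needs.
  set R : Set (LInftyDualBall X) := insert (radstrom 0) (s ∩ range radstrom) with hR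
  have hRrange : R ⊆ range radstrom := by
    rintro _ (rfl | hy)
    exacts [mem_range_self _, hy.2]
  have hsep : TopologicalSpace.IsSeparable R := by
    rw [hR, insert_eq]
    exact (Set.finite_singleton _).countable.isSeparable.union (hs.mono inter_subset_left)
  have := hsep.separableSpace
  obtain ⟨g, hg, hfg⟩ := h
  have h0 : radstrom (0 : CB X) ∈ R := mem_insert _ _
  let S : ℕ → SimpleFunc I (LInftyDualBall X) := SimpleFunc.approxOn g hg.measurable R _ h0
  have hS : ∀ n t, radstrom (Function.invFun radstrom (S n t)) = S n t := fun n t =>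
    Function.invFun_eq (hRrange (SimpleFunc.approxOn_mem hg.measurable h0 n t))
  refine ⟨fun n t => Function.invFun radstrom (S n t), fun n => ⟨?_, fun C => ?_⟩, ?_⟩
  · refine ((S n).finite_range.image (Function.invFun radstrom)).subset ?_
    rintro _ ⟨t, rfl⟩
    exact mem_image_of_mem _ (mem_range_self t)
  · exact ((S n).measurableSet_preimage (Function.invFun radstrom ⁻¹' {C})).nullMeasurableSet
  · filter_upwards [hmem, hfg] with t ht hgt
    have hcl : g t ∈ closure R := by
      rw [← hgt]
      exact subset_closure (mem_insert_of_mem _ ⟨ht, mem_range_self _⟩)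
    have := SimpleFunc.tendsto_approxOn hg.measurable h0 hcl
    rw [tendsto_iff_dist_tendsto_zero] at this
    refine this.congr fun n => ?_
    rw [← norm_radstrom_sub, hS, hgt, dist_eq_norm]

theorem bochnerMeasurable_iff {Γ : I → CB X} :
    BochnerMeasurable Γ ↔
      AEStronglyMeasurable (fun t => radstrom (Γ t)) (volume : Measure I) :=
  ⟨BochnerMeasurable.aestronglyMeasurable, bochnerMeasurable_of_aestronglyMeasurable⟩

theorem integrable_radstrom_iff {Γ : I → CB X} :
    Integrable (fun t => radstrom (Γ t)) (volume : Measure I) ↔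
      BochnerMeasurable Γ ∧ IntegrablyBounded Γ := by
  rw [bochnerMeasurable_iff]
  constructor
  · intro h
    refine ⟨h.aestronglyMeasurable, _, h.norm, ae_of_all _ fun t => ?_⟩
    rw [norm_radstrom]
    exact le_abs_self _
  · rintro ⟨h, b, hb, hle⟩
    refine hb.norm.mono h ?_
    filter_upwards [hle] with t ht
    rwa [norm_radstrom, Real.norm_eq_abs, Real.norm_eq_abs, abs_abs]

/-! The Pettis integral. -/

/-- `volume` on `I` is a probability measure, so a mean of values in a closed convex set stays
there. Off `A` the integrand is set to `0 = i({0})`, which lies in the range. -/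
theorem exists_radstrom_eq_setIntegral [CompleteSpace X] {Γ : I → CB X}
    (h : Integrable (fun t => radstrom (Γ t)) (volume : Measure I)) {A : Set I}
    (hA : NullMeasurableSet A) : ∃ C : CB X, radstrom C = ∫ t in A, radstrom (Γ t) := by
  classical
  have := convex_range_radstrom.integral_mem isClosed_range_radstrom (μ := (volume : Measure I))
    (f := A.indicator fun t => radstrom (Γ t)) (ae_of_all _ fun t => ?_) (h.indicator₀ hA)
  · rwa [integral_indicator₀ hA] at this
  · by_cases ht : t ∈ A
    · rw [indicator_of_mem ht]
      exact mem_range_self _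
    · rw [indicator_of_notMem ht]
      exact ⟨0, radstrom_zero⟩

theorem setIntegral_radstrom_apply {Γ : I → CB X} {A : Set I}
    (h : IntegrableOn (fun t => radstrom (Γ t)) A)
    (f : Metric.closedBall (0 : StrongDual ℝ X) 1) :
    (∫ t in A, radstrom (Γ t)) f = ∫ t in A, supp (f : StrongDual ℝ X) (Γ t) :=
  ((lp.evalCLM ℝ (fun _ : Metric.closedBall (0 : StrongDual ℝ X) 1 => ℝ) ∞ f).integral_comp_comm
    h).symm

theorem exists_smul_closedBall (f : StrongDual ℝ X) :
    ∃ (c : ℝ) (g : Metric.closedBall (0 : StrongDual ℝ X) 1),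
      0 ≤ c ∧ f = c • (g : StrongDual ℝ X) := by
  -- Adding 1 covers `f = 0` without a case distinction.
  have h0 : (0 : ℝ) < ‖f‖ + 1 := by positivity
  refine ⟨‖f‖ + 1, ⟨(‖f‖ + 1)⁻¹ • f, mem_closedBall_zero_iff.2 ?_⟩, h0.le, ?_⟩
  · rw [norm_smul, norm_inv, Real.norm_of_nonneg h0.le, inv_mul_le_iff₀ h0]
    linarith
  · rw [smul_inv_smul₀ h0.ne']

theorem exists_isPettisIntegral [CompleteSpace X] {Γ : I → CB X}
    (h : Integrable (fun t => radstrom (Γ t)) (volume : Measure I)) :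
    ∃ M : Set I → CB X, IsPettisIntegral Γ M ∧
      ∀ A, NullMeasurableSet A → radstrom (M A) = ∫ t in A, radstrom (Γ t) := by
  classical
  have hex : ∀ A : Set I, ∃ C : CB X, NullMeasurableSet A →
      radstrom C = ∫ t in A, radstrom (Γ t) := by
    intro A
    by_cases hA : NullMeasurableSet A
    · obtain ⟨C, hC⟩ := exists_radstrom_eq_setIntegral h hA
      exact ⟨C, fun _ => hC⟩
    · exact ⟨0, fun h => absurd h hA⟩
  choose M hM using hex
  refine ⟨M, ⟨fun f => ?_, fun A hA f => ?_⟩, hM⟩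
  · obtain ⟨c, g, hc, rfl⟩ := exists_smul_closedBall f
    simp only [supp_smul _ hc]
    exact ((lp.evalCLM ℝ (fun _ : Metric.closedBall (0 : StrongDual ℝ X) 1 => ℝ) ∞
      g).integrable_comp h).const_mul c
  · obtain ⟨c, g, hc, rfl⟩ := exists_smul_closedBall f
    simp only [supp_smul _ hc]
    rw [integral_const_mul, ← setIntegral_radstrom_apply h.integrableOn g, ← hM A hA]
    rfl

theorem variation_le_lintegral {Γ : I → CB X} {M : Set I → CB X}
    (hM : ∀ A, NullMeasurableSet A → radstrom (M A) = ∫ t in A, radstrom (Γ t)) :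
    variation M univ ≤ ∫⁻ t, ‖radstrom (Γ t)‖ₑ := by
  refine iSup₂_le fun P hP => ?_
  calc ∑ A ∈ P, ENNReal.ofReal (hnorm (M A))
      ≤ ∑ A ∈ P, ∫⁻ t in A, ‖radstrom (Γ t)‖ₑ := by
        refine Finset.sum_le_sum fun A hA => ?_
        rw [← norm_radstrom, ofReal_norm, hM A (hP.1 A hA)]
        exact enorm_integral_le_lintegral_enorm _
    _ = ∫⁻ t in ⋃ A ∈ P, id A, ‖radstrom (Γ t)‖ₑ :=
        (lintegral_biUnion_finset₀ (hP.2.1.mono' fun _ _ h => h.aedisjoint) hP.1 _).symm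
    _ ≤ ∫⁻ t, ‖radstrom (Γ t)‖ₑ := setLIntegral_le_lintegral _ _

theorem IsPettisIntegral.radstrom_eq {Γ : I → CB X} {M : Set I → CB X}
    (hM : IsPettisIntegral Γ M) {A : Set I} (hA : NullMeasurableSet A)
    (h : IntegrableOn (fun t => radstrom (Γ t)) A) :
    radstrom (M A) = ∫ t in A, radstrom (Γ t) := by
  ext f
  rw [setIntegral_radstrom_apply h, ← hM.2 A hA]
  rfl

theorem IsPettisIntegral.hnorm_empty {Γ : I → CB X} {M : Set I → CB X}
    (hM : IsPettisIntegral Γ M) : hnorm (M ∅) = 0 := by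
  rw [← norm_radstrom, hM.radstrom_eq MeasurableSet.empty.nullMeasurableSet integrableOn_empty]
  simp

theorem tsum_le_variation {M : Set I → CB X} (h0 : hnorm (M ∅) = 0) {A : ℕ → Set I}
    (hA : ∀ k, MeasurableSet (A k)) (hd : Pairwise (Function.onFun Disjoint A)) :
    ∑' k, ENNReal.ofReal (hnorm (M (A k))) ≤ variation M univ := by
  classical
  rw [ENNReal.tsum_eq_iSup_sum]
  refine iSup_le fun s => ?_
  -- The variation sums over a finite set of sets, so repeated pieces would count once. Nonempty
  -- disjoint pieces are distinct, and empty ones contribute nothing by `h0`.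
  set s' := s.filter fun k => (A k).Nonempty with hs'
  have hinj : Set.InjOn A (s' : Set ℕ) := by
    intro j hj k hk hjk
    by_contra hne
    obtain ⟨t, ht⟩ := (Finset.mem_filter.1 (Finset.mem_coe.1 hj)).2
    exact Set.disjoint_left.1 (hd hne) ht (hjk ▸ ht)
  set U : Set I := ⋃ k ∈ s', A k with hU
  have hUm : MeasurableSet U := s'.measurableSet_biUnion fun k _ => hA k
  have hsub : ∀ k ∈ s', A k ⊆ U := fun k hk => subset_biUnion_of_mem (u := A) hk
  have hP : IsMeasurablePartition (insert Uᶜ (s'.image A)) (univ : Set I) := by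
    refine ⟨fun B hB => ?_, ?_, ?_⟩
    · rcases Finset.mem_insert.1 hB with rfl | hB
      · exact hUm.compl.nullMeasurableSet
      · obtain ⟨k, -, rfl⟩ := Finset.mem_image.1 hB
        exact (hA k).nullMeasurableSet
    · rw [Finset.coe_insert, Finset.coe_image]
      refine (hinj.pairwiseDisjoint_image.2 fun j _ k _ hjk => hd hjk).insert ?_
      rintro _ ⟨k, hk, rfl⟩ -
      exact (disjoint_compl_left_iff_subset.2 (hsub k hk))
    · rw [Finset.coe_insert, sUnion_insert, Finset.coe_image, sUnion_image]
      exact compl_union_self U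
  calc ∑ k ∈ s, ENNReal.ofReal (hnorm (M (A k)))
      = ∑ k ∈ s', ENNReal.ofReal (hnorm (M (A k))) := by
        refine (Finset.sum_filter_of_ne fun k _ hk => ?_).symm
        by_contra hemp
        rw [not_nonempty_iff_eq_empty.1 hemp, h0, ENNReal.ofReal_zero] at hk
        exact hk rfl
    _ = ∑ B ∈ s'.image A, ENNReal.ofReal (hnorm (M B)) := by
        rw [Finset.sum_image hinj]
    _ ≤ ∑ B ∈ insert Uᶜ (s'.image A), ENNReal.ofReal (hnorm (M B)) :=
        Finset.sum_le_sum_of_subset (Finset.subset_insert _ _)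
    _ ≤ variation M univ := le_iSup₂ (f := fun (P : Finset (Set I))
        (_ : IsMeasurablePartition P univ) => ∑ B ∈ P, ENNReal.ofReal (hnorm (M B))) _ hP

/-- A strongly measurable function has oscillation at most `2 * r` on the pieces of a countable
measurable partition. -/
theorem exists_partition_norm_sub_le {α E : Type*} [MeasurableSpace α] [NormedAddCommGroup E]
    {f : α → E} (hf : StronglyMeasurable f) {r : ℝ} (hr : 0 < r) :
    ∃ (A : ℕ → Set α) (c : ℕ → E), (∀ k, MeasurableSet (A k)) ∧
      Pairwise (Function.onFun Disjoint A) ∧ ⋃ k, A k = univ ∧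
      ∀ k, ∀ t ∈ A k, ‖f t - c k‖ ≤ r := by
  obtain ⟨s, hs, hsub⟩ := hf.isSeparable_range
  obtain ⟨c, hc⟩ := (hs.insert (0 : E)).exists_eq_range (insert_nonempty _ _)
  let B : ℕ → Set α := fun k => {t | ‖f t - c k‖ ≤ r}
  have hB : ∀ k, MeasurableSet (B k) := fun k =>
    measurableSet_le (hf.sub stronglyMeasurable_const).norm.measurable measurable_const
  refine ⟨disjointed B, c, fun k => MeasurableSet.disjointed hB k, disjoint_disjointed B, ?_,
    fun k t ht => disjointed_subset B k ht⟩
  rw [iUnion_disjointed, eq_univ_iff_forall]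
  intro t
  obtain ⟨y, hy, hty⟩ := Metric.mem_closure_iff.1 (hsub (mem_range_self t)) r hr
  have : y ∈ range c := hc ▸ mem_insert_of_mem _ hy
  obtain ⟨k, rfl⟩ := this
  exact mem_iUnion.2 ⟨k, by rw [dist_eq_norm] at hty; exact hty.le⟩

/-- On a piece where `g` is within 1 of a constant `c k`, it is bounded, so its Bochner integral
exists and is `i(M(A k))`. Thus `‖c k‖ λ(A k)` is at most `‖M(A k)‖_h + λ(A k)`, and replacing `c k`
by `g` costs another `λ(A k)`. -/
theorem IsPettisIntegral.integrable_of_variation_lt_top {Γ : I → CB X} {M : Set I → CB X}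
    (hM : IsPettisIntegral Γ M) (hvar : variation M univ < ∞)
    (h : AEStronglyMeasurable (fun t => radstrom (Γ t)) (volume : Measure I)) :
    Integrable (fun t => radstrom (Γ t)) (volume : Measure I) := by
  obtain ⟨g, hg, hfg⟩ := h
  obtain ⟨A, c, hA, hd, hU, hc⟩ := exists_partition_norm_sub_le hg one_pos
  have hpiece : ∀ k, ∫⁻ t in A k, ‖g t‖ₑ ≤
      ENNReal.ofReal (hnorm (M (A k))) + 2 * volume (A k) := by
    intro k
    have hgi : IntegrableOn g (A k) := by
      refine IntegrableOn.of_bound (measure_lt_top _ _) hg.aestronglyMeasurable (‖c k‖ + 1) ?_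
      filter_upwards [ae_restrict_mem (hA k)] with t ht
      have := norm_le_norm_add_norm_sub' (g t) (c k)
      linarith [hc k t ht]
    have hMk : radstrom (M (A k)) = ∫ t in A k, g t := by
      rw [hM.radstrom_eq (hA k).nullMeasurableSet (hgi.congr (ae_restrict_of_ae hfg.symm))]
      exact integral_congr_ae (ae_restrict_of_ae hfg)
    have hdiff : ‖(∫ t in A k, g t) - volume.real (A k) • c k‖ ≤ volume.real (A k) := by
      rw [← setIntegral_const, ← integral_sub hgi (integrable_const _)]
      have := norm_setIntegral_le_of_norm_le_const (μ := (volume : Measure I)) (s := A k)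
        (f := fun t => g t - c k) (measure_lt_top _ _) fun t ht => hc k t ht
      simpa using this
    have hnorm : ‖c k‖ * volume.real (A k) ≤ hnorm (M (A k)) + volume.real (A k) := by
      rw [← norm_radstrom, hMk]
      have := norm_le_norm_add_norm_sub (∫ t in A k, g t) (volume.real (A k) • c k)
      rw [norm_smul, Real.norm_of_nonneg measureReal_nonneg] at this
      linarith
    calc ∫⁻ t in A k, ‖g t‖ₑ ≤ ∫⁻ _ in A k, ENNReal.ofReal (‖c k‖ + 1) := by
          refine setLIntegral_mono' (hA k) fun t ht => ?_
          rw [← ofReal_norm]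
          refine ENNReal.ofReal_le_ofReal ?_
          have := norm_le_norm_add_norm_sub' (g t) (c k)
          linarith [hc k t ht]
      _ = ENNReal.ofReal ((‖c k‖ + 1) * volume.real (A k)) := by
          rw [setLIntegral_const, ENNReal.ofReal_mul (by positivity), ofReal_measureReal]
      _ ≤ ENNReal.ofReal (MultiIntegral.hnorm (M (A k)) + 2 * volume.real (A k)) :=
          ENNReal.ofReal_le_ofReal (by linarith)
      _ = _ := by
          rw [ENNReal.ofReal_add (by rw [← norm_radstrom]; positivity) (by positivity),
            ENNReal.ofReal_mul zero_le_two, ofReal_measureReal, ENNReal.ofReal_ofNat]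
  refine Integrable.congr ⟨hg.aestronglyMeasurable, ?_⟩ hfg.symm
  calc ∫⁻ t, ‖g t‖ₑ = ∑' k, ∫⁻ t in A k, ‖g t‖ₑ := by
        rw [← lintegral_iUnion hA hd, hU, setLIntegral_univ]
    _ ≤ ∑' k, (ENNReal.ofReal (hnorm (M (A k))) + 2 * volume (A k)) := ENNReal.tsum_le_tsum hpiece
    _ = ∑' k, ENNReal.ofReal (hnorm (M (A k))) + 2 * volume (univ : Set I) := by
        rw [ENNReal.tsum_add, ENNReal.tsum_mul_left, ← measure_iUnion hd hA, hU]
    _ ≤ variation M univ + 2 * volume (univ : Set I) :=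
        add_le_add_left (tsum_le_variation hM.hnorm_empty hA hd) _
    _ < ∞ := ENNReal.add_lt_top.2 ⟨hvar, ENNReal.mul_lt_top (by simp) (measure_lt_top _ _)⟩

theorem integrable_radstrom_iff_pettis [CompleteSpace X] {Γ : I → CB X} :
    Integrable (fun t => radstrom (Γ t)) (volume : Measure I) ↔
      BochnerMeasurable Γ ∧ ∃ M : Set I → CB X, IsPettisIntegral Γ M ∧ variation M univ < ∞ := by
  rw [bochnerMeasurable_iff]
  constructor
  · intro h
    obtain ⟨M, hM, hMr⟩ := exists_isPettisIntegral h
    exact ⟨h.aestronglyMeasurable, M, hM, (variation_le_lintegral hMr).trans_lt h.2⟩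
  · rintro ⟨h, M, hM, hvar⟩
    exact hM.integrable_of_variation_lt_top hvar h

/-! Bochner integrable functions are variationally McShane integrable. -/

theorem len_nonneg (J : NonemptyInterval I) : 0 ≤ len J :=
  sub_nonneg.2 J.fst_le_snd

theorem volume_real_Icc (J : NonemptyInterval I) :
    (volume : Measure I).real (Icc J.fst J.snd) = len J := by
  rw [measureReal_def, unitInterval.volume_Icc]
  exact ENNReal.toReal_ofReal (len_nonneg J)

/-- Nonoverlapping intervals meet only in endpoints, which are null. -/
theorem McShanePartition.sum_setIntegral {E : Type*} [NormedAddCommGroup E] [NormedSpace ℝ E]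
    (P : McShanePartition) {f : I → E} (hf : Integrable f) :
    ∑ k, ∫ t in Icc (P.interval k).fst (P.interval k).snd, f t = ∫ t, f t := by
  rw [← setIntegral_univ, ← P.cover, integral_iUnion_ae
    (fun k => measurableSet_Icc.nullMeasurableSet) ?_ hf.integrableOn, tsum_fintype]
  intro j k hjk
  exact (P.nonoverlapping hjk).aedisjoint.congr Ioo_ae_eq_Icc.symm Ioo_ae_eq_Icc.symm

/-- Take `g` continuous and `L¹`-close to `f`. The gauge controls the oscillation of `g`. For the
error `‖f - g‖` at the tag, Vitali–Carathéodory gives a lower semicontinuous `u` strictly above it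
with small integral; near `t` one still has `u s > ‖f t - g t‖`, so integrating `u` pays for the
tags. -/
theorem exists_gauge_sum_setIntegral_norm_sub_lt {E : Type*} [NormedAddCommGroup E]
    [NormedSpace ℝ E] {f : I → E} (hf : Integrable f) {ε : ℝ} (hε : 0 < ε) :
    ∃ δ : I → ℝ, (∀ t, 0 < δ t) ∧ ∀ P : McShanePartition, P.IsFine δ →
      ∑ k, ∫ s in Icc (P.interval k).fst (P.interval k).snd, ‖f s - f (P.tag k)‖ < ε := by
  obtain ⟨g, hg, hgi⟩ := hf.exists_boundedContinuous_integral_sub_le (ε := ε / 4) (by linarith)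
  have hfg : Integrable (fun t => ‖f t - g t‖) := (hf.sub hgi).norm
  obtain ⟨u, hlt, hlsc, hfin, hui, hu⟩ :=
    exists_lt_lowerSemicontinuous_integral_gt_nnreal (μ := (volume : Measure I))
      (fun t => ‖f t - g t‖₊) hfg (ε := ε / 4) (by linarith)
  have hδ : ∀ t, ∃ r : ℝ, 0 < r ∧ Metric.closedBall t r ⊆
      {s | ‖g s - g t‖ < ε / 8 ∧ (‖f t - g t‖₊ : ℝ≥0∞) < u s} := by
    intro t
    refine Metric.nhds_basis_closedBall.mem_iff.1 (Filter.inter_mem ?_ (hlsc t _ (hlt t)))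
    have := Metric.tendsto_nhds.1 (g.continuous.tendsto t) (ε / 8) (by linarith)
    simp only [dist_eq_norm] at this
    exact this
  choose δ hδ0 hδ using hδ
  refine ⟨δ, hδ0, fun P hP => ?_⟩
  have hbi : Integrable (fun s => ‖f s - g s‖ + ε / 8 + (u s).toReal) :=
    (hfg.add (integrable_const _)).add hui
  calc ∑ k, ∫ s in Icc (P.interval k).fst (P.interval k).snd, ‖f s - f (P.tag k)‖
      ≤ ∑ k, ∫ s in Icc (P.interval k).fst (P.interval k).snd,
          (‖f s - g s‖ + ε / 8 + (u s).toReal) := by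
        refine Finset.sum_le_sum fun k _ => ?_
        refine integral_mono_ae (hf.sub (integrable_const _)).norm.integrableOn hbi.integrableOn ?_
        filter_upwards [ae_restrict_mem measurableSet_Icc, ae_restrict_of_ae hfin] with s hs hfs
        obtain ⟨h1, h2⟩ := hδ _ (hP k hs)
        have h3 : ‖f (P.tag k) - g (P.tag k)‖ < (u s).toReal := by
          have := (ENNReal.toReal_lt_toReal ENNReal.coe_ne_top hfs.ne).2 h2
          simpa using this
        have h4 : f s - f (P.tag k) = (f s - g s) + (g s - g (P.tag k)) -
            (f (P.tag k) - g (P.tag k)) := by abel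
        rw [h4]
        have h5 := norm_sub_le ((f s - g s) + (g s - g (P.tag k))) (f (P.tag k) - g (P.tag k))
        have h6 := norm_add_le (f s - g s) (g s - g (P.tag k))
        linarith
    _ = ∫ s, (‖f s - g s‖ + ε / 8 + (u s).toReal) := P.sum_setIntegral hbi
    _ = (∫ s, ‖f s - g s‖) + ε / 8 + ∫ s, (u s).toReal := by
        have h := integral_add (hfg.add (integrable_const (ε / 8))) hui
        have h' := integral_add hfg (integrable_const (μ := (volume : Measure I)) (ε / 8))
        simp only [Pi.add_apply] at h
        rw [h, h']
        simp
    _ < ε := by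
        simp only [coe_nnnorm] at hu
        -- The total is at most `ε/4 + ε/8 + (ε/4 + ε/4) < ε`.
        linarith

theorem norm_setIntegral_sub_smul_le {E : Type*} [NormedAddCommGroup E] [NormedSpace ℝ E]
    [CompleteSpace E] {f : I → E} (hf : Integrable f) (J : NonemptyInterval I) (y : E) :
    ‖(∫ s in Icc J.fst J.snd, f s) - len J • y‖ ≤ ∫ s in Icc J.fst J.snd, ‖f s - y‖ := by
  rw [← volume_real_Icc, ← setIntegral_const, ← integral_sub hf.integrableOn (integrable_const _)]
  exact norm_integral_le_integral_norm _

theorem isMcShaneIntegral_of_integrable {Γ : I → CB X} {K : CB X}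
    (h : Integrable (fun t => radstrom (Γ t)) (volume : Measure I))
    (hK : radstrom K = ∫ t, radstrom (Γ t)) : IsMcShaneIntegral Γ K := by
  intro ε hε
  obtain ⟨δ, hδ0, hδ⟩ := exists_gauge_sum_setIntegral_norm_sub_lt h hε
  refine ⟨δ, hδ0, fun P hP => ?_⟩
  rw [McShanePartition.riemannSum, hausdorffDist_closure_sum_smul _ fun k => len_nonneg _, hK,
    ← P.sum_setIntegral h, ← Finset.sum_sub_distrib]
  exact (norm_sum_le _ _).trans_lt ((Finset.sum_le_sum fun k _ =>
    norm_setIntegral_sub_smul_le h _ _).trans_lt (hδ P hP))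

theorem radstrom_indicator (A : Set I) (Γ : I → CB X) :
    (fun t => radstrom (A.indicator Γ t)) = A.indicator fun t => radstrom (Γ t) :=
  (indicator_comp_of_zero (g := radstrom) radstrom_zero).symm

theorem variationallyMcShaneIntegrable_of_integrable [CompleteSpace X] {Γ : I → CB X}
    (h : Integrable (fun t => radstrom (Γ t)) (volume : Measure I)) :
    VariationallyMcShaneIntegrable Γ := by
  have hex : ∀ J : NonemptyInterval I, ∃ C : CB X,
      radstrom C = ∫ t in Icc J.fst J.snd, radstrom (Γ t) := fun J =>
    exists_radstrom_eq_setIntegral h measurableSet_Icc.nullMeasurableSet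
  choose Φ hΦ using hex
  refine ⟨Φ, fun J => isMcShaneIntegral_of_integrable ?_ ?_, fun ε hε => ?_⟩
  · rw [radstrom_indicator]
    exact h.indicator measurableSet_Icc
  · rw [hΦ, radstrom_indicator, integral_indicator measurableSet_Icc]
  · obtain ⟨δ, hδ0, hδ⟩ := exists_gauge_sum_setIntegral_norm_sub_lt h hε
    refine ⟨δ, hδ0, fun P hP => lt_of_le_of_lt (Finset.sum_le_sum fun k _ => ?_) (hδ P hP)⟩
    rw [hausdorffDist_smul (len_nonneg _), hΦ]
    exact norm_setIntegral_sub_smul_le h _ _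

/-! Repeated bisection of an interval. -/

/-- The midpoint of an interval. -/
def mid (J : NonemptyInterval I) : I :=
  ⟨((J.fst : ℝ) + J.snd) / 2,
    ⟨by linarith [J.fst.2.1, J.snd.2.1], by linarith [J.fst.2.2, J.snd.2.2]⟩⟩

theorem fst_le_mid (J : NonemptyInterval I) : J.fst ≤ mid J := by
  have h : (J.fst : ℝ) ≤ J.snd := J.fst_le_snd
  change (J.fst : ℝ) ≤ (J.fst + J.snd) / 2
  linarith

theorem mid_le_snd (J : NonemptyInterval I) : mid J ≤ J.snd := by
  have h : (J.fst : ℝ) ≤ J.snd := J.fst_le_snd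
  change ((J.fst : ℝ) + J.snd) / 2 ≤ J.snd
  linarith

/-- The left half of an interval. -/
def leftHalf (J : NonemptyInterval I) : NonemptyInterval I := ⟨(J.fst, mid J), fst_le_mid J⟩

/-- The right half of an interval. -/
def rightHalf (J : NonemptyInterval I) : NonemptyInterval I := ⟨(mid J, J.snd), mid_le_snd J⟩

theorem len_leftHalf (J : NonemptyInterval I) : len (leftHalf J) = len J / 2 := by
  change ((J.fst : ℝ) + J.snd) / 2 - J.fst = ((J.snd : ℝ) - J.fst) / 2
  ring

theorem len_rightHalf (J : NonemptyInterval I) : len (rightHalf J) = len J / 2 := by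
  change (J.snd : ℝ) - ((J.fst : ℝ) + J.snd) / 2 = ((J.snd : ℝ) - J.fst) / 2
  ring

theorem len_pos_iff {J : NonemptyInterval I} : 0 < len J ↔ J.fst < J.snd :=
  sub_pos

/-- The interval of the `n`-th generation of bisections of `J` which contains the point `t`. -/
def cell : ℕ → NonemptyInterval I → I → NonemptyInterval I
  | 0, J, _ => J
  | n + 1, J, t => if t < mid J then cell n (leftHalf J) t else cell n (rightHalf J) t

theorem cell_zero (J : NonemptyInterval I) (t : I) : cell 0 J t = J := rfl

theorem cell_succ (n : ℕ) (J : NonemptyInterval I) (t : I) :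
    cell (n + 1) J t = if t < mid J then cell n (leftHalf J) t else cell n (rightHalf J) t := rfl

theorem len_cell (n : ℕ) (J : NonemptyInterval I) (t : I) : len (cell n J t) = len J / 2 ^ n := by
  induction n generalizing J with
  | zero => simp [cell_zero]
  | succ n ih =>
    rw [cell_succ]
    split_ifs
    · rw [ih, len_leftHalf, pow_succ, div_div, mul_comm]
    · rw [ih, len_rightHalf, pow_succ, div_div, mul_comm]

theorem mem_cell (n : ℕ) {J : NonemptyInterval I} {t : I} (ht : t ∈ Icc J.fst J.snd) :
    t ∈ Icc (cell n J t).fst (cell n J t).snd := by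
  induction n generalizing J with
  | zero => exact ht
  | succ n ih =>
    rw [cell_succ]
    split_ifs with h
    · exact ih ⟨ht.1, h.le⟩
    · exact ih ⟨not_lt.1 h, ht.2⟩

theorem Icc_subset_closedBall {J : NonemptyInterval I} {t : I} (ht : t ∈ Icc J.fst J.snd) {r : ℝ}
    (hr : len J ≤ r) : Icc J.fst J.snd ⊆ Metric.closedBall t r := by
  intro s hs
  have h1 : (J.fst : ℝ) ≤ s := hs.1
  have h2 : (s : ℝ) ≤ J.snd := hs.2
  have h3 : (J.fst : ℝ) ≤ t := ht.1
  have h4 : (t : ℝ) ≤ J.snd := ht.2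
  rw [len] at hr
  rw [Metric.mem_closedBall, Subtype.dist_eq, Real.dist_eq, abs_le]
  constructor <;> linarith

theorem stronglyMeasurable_comp_cell {E : Type*} [TopologicalSpace E]
    (G : NonemptyInterval I → E) (n : ℕ) (J : NonemptyInterval I) :
    StronglyMeasurable fun t => G (cell n J t) := by
  induction n generalizing J with
  | zero => exact stronglyMeasurable_const (b := G J)
  | succ n ih =>
    have : (fun t => G (cell (n + 1) J t)) = fun t =>
        if t < mid J then G (cell n (leftHalf J) t) else G (cell n (rightHalf J) t) := by
      funext t
      rw [cell_succ, apply_ite G]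
    rw [this]
    exact StronglyMeasurable.ite measurableSet_Iio (ih _) (ih _)

/-! Fine tagged partitions which are built by repeated bisection. -/

/-- `FineSum δ c J v` says that `v = ∑ c(J_k, t_k)` for a `δ`-fine tagged partition `(J_k, t_k)`
of `J` which arises by repeated bisection. -/
inductive FineSum (δ : I → ℝ) (c : NonemptyInterval I → I → ℝ) : NonemptyInterval I → ℝ → Prop
  | single (J : NonemptyInterval I) (t : I) (hJ : J.fst < J.snd)
      (ht : Icc J.fst J.snd ⊆ Metric.closedBall t (δ t)) : FineSum δ c J (c J t)
  | split (J : NonemptyInterval I) (v w : ℝ) (hv : FineSum δ c (leftHalf J) v)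
      (hw : FineSum δ c (rightHalf J) w) : FineSum δ c J (v + w)

theorem FineSum.nonneg {δ : I → ℝ} {c : NonemptyInterval I → I → ℝ} (hc : ∀ J t, 0 ≤ c J t)
    {J : NonemptyInterval I} {v : ℝ} (h : FineSum δ c J v) : 0 ≤ v := by
  induction h with
  | single J t => exact hc J t
  | split J v w _ _ hv hw => exact add_nonneg hv hw

/-- The index is an arbitrary finite type, so that gluing the two halves is a disjoint sum of index
types. -/
theorem FineSum.exists_family {δ : I → ℝ} {c : NonemptyInterval I → I → ℝ}
    {J : NonemptyInterval I} {v : ℝ} (h : FineSum δ c J v) :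
    ∃ (ι : Type) (_ : Fintype ι) (K : ι → NonemptyInterval I) (τ : ι → I),
      (∀ k, (K k).fst < (K k).snd) ∧
      (Pairwise fun j k => Disjoint (Ioo (K j).fst (K j).snd) (Ioo (K k).fst (K k).snd)) ∧
      ⋃ k, Icc (K k).fst (K k).snd = Icc J.fst J.snd ∧
      (∀ k, Icc (K k).fst (K k).snd ⊆ Metric.closedBall (τ k) (δ (τ k))) ∧
      ∑ k, c (K k) (τ k) = v := by
  induction h with
  | single J t hJ ht =>
    exact ⟨Unit, inferInstance, fun _ => J, fun _ => t, fun _ => hJ, Subsingleton.pairwise,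
      iUnion_const _, fun _ => ht, by simp⟩
  | split J v w _ _ hv hw =>
    obtain ⟨ι, _, K, τ, hK, hd, hU, hf, hs⟩ := hv
    obtain ⟨κ, _, L, ρ, hL, hd', hU', hf', hs'⟩ := hw
    have hcross : ∀ i j, Disjoint (Ioo (K i).fst (K i).snd) (Ioo (L j).fst (L j).snd) := by
      intro i j
      have h1 : (K i).snd ∈ Icc (leftHalf J).fst (leftHalf J).snd :=
        hU ▸ mem_iUnion.2 ⟨i, right_mem_Icc.2 (hK i).le⟩
      have h2 : (L j).fst ∈ Icc (rightHalf J).fst (rightHalf J).snd :=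
        hU' ▸ mem_iUnion.2 ⟨j, left_mem_Icc.2 (hL j).le⟩
      refine Set.disjoint_left.2 fun x hx hx' => ?_
      exact lt_irrefl x ((hx.2.trans_le h1.2).trans_le (le_trans h2.1 hx'.1.le))
    refine ⟨ι ⊕ κ, inferInstance, Sum.elim K L, Sum.elim τ ρ, ?_, ?_, ?_, ?_, ?_⟩
    · rintro (i | j)
      exacts [hK i, hL j]
    · rintro (i | i) (j | j) hij
      · exact hd fun h => hij (congrArg _ h)
      · exact hcross i j
      · exact (hcross j i).symm
      · exact hd' fun h => hij (congrArg _ h)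
    · rw [iUnion_sum]
      simp only [Sum.elim_inl, Sum.elim_inr]
      rw [hU, hU']
      exact Icc_union_Icc_eq_Icc (fst_le_mid J) (mid_le_snd J)
    · rintro (i | j)
      exacts [hf i, hf' j]
    · rw [Fintype.sum_sum_type]
      simp only [Sum.elim_inl, Sum.elim_inr]
      rw [hs, hs']

/-- The interval `[0,1]`. -/
def unitCell : NonemptyInterval I := ⟨(0, 1), zero_le_one⟩

theorem mem_unitCell (t : I) : t ∈ Icc unitCell.fst unitCell.snd :=
  ⟨unitInterval.nonneg', unitInterval.le_one'⟩

theorem len_unitCell : len unitCell = 1 := by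
  simp [len, unitCell]

theorem FineSum.exists_partition {δ : I → ℝ} {c : NonemptyInterval I → I → ℝ} {v : ℝ}
    (h : FineSum δ c unitCell v) :
    ∃ P : McShanePartition, P.IsFine δ ∧ ∑ k, c (P.interval k) (P.tag k) = v := by
  obtain ⟨ι, _, K, τ, hK, hd, hU, hf, hs⟩ := h.exists_family
  let e := (Fintype.equivFin ι).symm
  refine ⟨⟨Fintype.card ι, fun k => K (e k), fun k => τ (e k), fun k => hK _,
    fun j k hjk => hd (e.injective.ne hjk), ?_⟩, fun k => hf _, ?_⟩
  · rw [e.surjective.iUnion_comp fun k => Icc (K k).fst (K k).snd, hU]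
    exact eq_univ_of_forall mem_unitCell
  · rw [← hs]
    exact e.sum_comp fun k => c (K k) (τ k)

/-- Short intervals are fine for tags at which `f` is bounded. -/
theorem exists_fine_tag {E : Type*} [NormedAddCommGroup E] (f : I → E) {δ : I → ℝ}
    (hδ : ∀ t, 0 < δ t) :
    ∃ r > 0, ∃ R, 0 ≤ R ∧ ∀ J : NonemptyInterval I, len J ≤ r →
      ∃ t, Icc J.fst J.snd ⊆ Metric.closedBall t (δ t) ∧ ‖f t‖ ≤ R := by
  -- Finitely many tags serve all short intervals: a Lebesgue number of the cover gives `r`, and the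
  -- sum of the norms at these tags gives `R`. McShane tags may lie outside their intervals, which
  -- makes this possible.
  obtain ⟨T, -, hT⟩ := isCompact_univ.elim_nhds_subcover (fun t : I => Metric.ball t (δ t))
    fun t _ => Metric.ball_mem_nhds t (hδ t)
  obtain ⟨r, hr, hball⟩ := lebesgue_number_lemma_of_metric (ι := T)
    (c := fun t => Metric.ball (t : I) (δ t)) (isCompact_univ (X := I))
    (fun _ => Metric.isOpen_ball) (by simpa [iUnion_subtype] using hT)
  refine ⟨r / 2, half_pos hr, ∑ t ∈ T, ‖f t‖, Finset.sum_nonneg fun _ _ => norm_nonneg _,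
    fun J hJ => ?_⟩
  obtain ⟨t, ht⟩ := hball J.fst (mem_univ _)
  refine ⟨t, ?_, Finset.single_le_sum (f := fun t => ‖f t‖) (fun _ _ => norm_nonneg _) t.2⟩
  calc Icc J.fst J.snd ⊆ Metric.closedBall J.fst (r / 2) :=
        Icc_subset_closedBall (left_mem_Icc.2 J.fst_le_snd) hJ
    _ ⊆ Metric.ball J.fst r := Metric.closedBall_subset_ball (half_lt_self hr)
    _ ⊆ Metric.ball (t : I) (δ t) := ht
    _ ⊆ Metric.closedBall (t : I) (δ t) := Metric.ball_subset_closedBall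

/-! ### Differentiation of a variational primitive along dyadic cells. -/

section Differentiation

variable {E : Type*} [NormedAddCommGroup E] [NormedSpace ℝ E]
  (F : NonemptyInterval I → E) (f : I → E)

/-- The mean of an interval function over an interval. -/
def mean (J : NonemptyInterval I) : E := (len J)⁻¹ • F J

theorem norm_sub_smul_eq {J : NonemptyInterval I} (hJ : J.fst < J.snd) (y : E) :
    ‖F J - len J • y‖ = len J * ‖mean F J - y‖ := by
  have h := len_pos_iff.2 hJ
  rw [mean, ← Real.norm_of_nonneg h.le, ← norm_smul, Real.norm_of_nonneg h.le, smul_sub,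
    smul_inv_smul₀ h.ne']

/-- This is the `L¹` bound on dyadic means. A cell `K` of the last generation has a tag `t` with `‖f
t‖ ≤ R`, whence `‖F K‖ ≤ ‖F K - len K • f t‖ + R * len K`; these add up over the cells. -/
theorem exists_fineSum_lintegral_le {δ : I → ℝ} {r R : ℝ} (hR : 0 ≤ R)
    (htag : ∀ J : NonemptyInterval I, len J ≤ r →
      ∃ t, Icc J.fst J.snd ⊆ Metric.closedBall t (δ t) ∧ ‖f t‖ ≤ R)
    (n : ℕ) {J : NonemptyInterval I} (hJ : 0 < len J) (hn : len J ≤ 2 ^ n * r) :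
    ∃ v, FineSum δ (fun K t => ‖F K - len K • f t‖) J v ∧
      ∫⁻ t in Icc J.fst J.snd, ‖mean F (cell n J t)‖ₑ ≤ ENNReal.ofReal (v + R * len J) := by
  induction n generalizing J with
  | zero =>
    obtain ⟨t, ht, hft⟩ := htag J (by simpa using hn)
    refine ⟨_, FineSum.single J t (len_pos_iff.1 hJ) ht, ?_⟩
    simp only [cell_zero]
    rw [setLIntegral_const, ← ofReal_norm, unitInterval.volume_Icc,
      ← ENNReal.ofReal_mul (norm_nonneg _)]
    refine ENNReal.ofReal_le_ofReal ?_
    change ‖mean F J‖ * len J ≤ _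
    rw [norm_sub_smul_eq F (len_pos_iff.1 hJ), mul_comm, mul_comm R, ← mul_add]
    refine mul_le_mul_of_nonneg_left ?_ hJ.le
    have := norm_le_norm_add_norm_sub' (mean F J) (f t)
    linarith
  | succ n ih =>
    have hl : len (leftHalf J) = len J / 2 := len_leftHalf J
    have hr : len (rightHalf J) = len J / 2 := len_rightHalf J
    rw [pow_succ] at hn
    obtain ⟨v, hv, hv'⟩ := ih (J := leftHalf J) (by linarith) (by linarith)
    obtain ⟨w, hw, hw'⟩ := ih (J := rightHalf J) (by linarith) (by linarith)
    refine ⟨v + w, FineSum.split J v w hv hw, ?_⟩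
    have hv0 := hv.nonneg fun _ _ => norm_nonneg _
    have hw0 := hw.nonneg fun _ _ => norm_nonneg _
    -- Half-open on the left, because `cell` sends the midpoint to the right half.
    have hsub : Icc J.fst J.snd ⊆ Ico J.fst (mid J) ∪ Icc (mid J) J.snd := by
      rw [Ico_union_Icc_eq_Icc (fst_le_mid J) (mid_le_snd J)]
    calc ∫⁻ t in Icc J.fst J.snd, ‖mean F (cell (n + 1) J t)‖ₑ
        ≤ ∫⁻ t in Ico J.fst (mid J) ∪ Icc (mid J) J.snd, ‖mean F (cell (n + 1) J t)‖ₑ :=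
          lintegral_mono_set hsub
      _ ≤ (∫⁻ t in Ico J.fst (mid J), ‖mean F (cell (n + 1) J t)‖ₑ) +
            ∫⁻ t in Icc (mid J) J.snd, ‖mean F (cell (n + 1) J t)‖ₑ := lintegral_union_le _ _ _
      _ = (∫⁻ t in Ico J.fst (mid J), ‖mean F (cell n (leftHalf J) t)‖ₑ) +
            ∫⁻ t in Icc (mid J) J.snd, ‖mean F (cell n (rightHalf J) t)‖ₑ := by
          congr 1
          · refine setLIntegral_congr_fun measurableSet_Ico fun t ht => ?_
            simp only [cell_succ, if_pos ht.2]
          · refine setLIntegral_congr_fun measurableSet_Icc fun t ht => ?_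
            simp only [cell_succ, if_neg (not_lt.2 ht.1)]
      _ ≤ ENNReal.ofReal (v + R * len (leftHalf J)) +
            ENNReal.ofReal (w + R * len (rightHalf J)) :=
          add_le_add ((lintegral_mono_set Ico_subset_Icc_self).trans hv') hw'
      _ = ENNReal.ofReal (v + w + R * len J) := by
          rw [hl, hr, ← ENNReal.ofReal_add (by positivity) (by positivity)]
          congr 1
          ring

/-- The points of `J` which are fine tags, with mean far from the value of `f`, of one of the first
`N + 1` generations of bisections of `J`. -/
def farSet (δ : I → ℝ) (η : ℝ) (N : ℕ) (J : NonemptyInterval I) : Set I :=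
  {t ∈ Icc J.fst J.snd | ∃ k ≤ N,
    Icc (cell k J t).fst (cell k J t).snd ⊆ Metric.closedBall t (δ t) ∧
      η ≤ ‖mean F (cell k J t) - f t‖}

theorem farSet_mono (δ : I → ℝ) (η : ℝ) (J : NonemptyInterval I) :
    Monotone fun N => farSet F f δ η N J := by
  rintro M N hMN t ⟨ht, k, hk, h⟩
  exact ⟨ht, k, hk.trans hMN, h⟩

theorem exists_fineSum {δ : I → ℝ} (hδ : ∀ t, 0 < δ t) {J : NonemptyInterval I}
    (hJ : 0 < len J) : ∃ v, FineSum δ (fun K t => ‖F K - len K • f t‖) J v := by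
  obtain ⟨r, hr, R, hR, htag⟩ := exists_fine_tag f hδ
  obtain ⟨n, hn⟩ := pow_unbounded_of_one_lt (len J / r) one_lt_two
  obtain ⟨v, hv, -⟩ :=
    exists_fineSum_lintegral_le F f hR htag n hJ ((div_lt_iff₀ hr).1 hn).le
  exact ⟨v, hv⟩

theorem exists_fineSum_of_far {δ : I → ℝ} {η : ℝ} {J : NonemptyInterval I} (hJ : 0 < len J)
    (hη : 0 ≤ η) (h : ∃ t ∈ Icc J.fst J.snd, Icc J.fst J.snd ⊆ Metric.closedBall t (δ t) ∧
      η ≤ ‖mean F J - f t‖) {N : ℕ} :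
    ∃ v, FineSum δ (fun K t => ‖F K - len K • f t‖) J v ∧
      η * (volume : Measure I).real (farSet F f δ η N J) ≤ v := by
  obtain ⟨t, -, ht, hfar⟩ := h
  refine ⟨_, FineSum.single J t (len_pos_iff.1 hJ) ht, ?_⟩
  rw [norm_sub_smul_eq F (len_pos_iff.1 hJ), mul_comm, ← volume_real_Icc J]
  exact mul_le_mul (measureReal_mono fun s hs => hs.1) hfar hη measureReal_nonneg

/-- A stopping argument in place of a covering theorem: bisect until a cell contains a far tag of
its own, and keep that cell with that tag. It costs at least `η` times its length, hence `η` times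
the measure of the far points in it. Cells never stopped contain no far points and are filled by any
fine sum. -/
theorem exists_fineSum_ge_measure_farSet {δ : I → ℝ} (hδ : ∀ t, 0 < δ t) {η : ℝ} (hη : 0 ≤ η)
    (N : ℕ) {J : NonemptyInterval I} (hJ : 0 < len J) :
    ∃ v, FineSum δ (fun K t => ‖F K - len K • f t‖) J v ∧
      η * (volume : Measure I).real (farSet F f δ η N J) ≤ v := by
  induction N generalizing J with
  | zero =>
    by_cases h : ∃ t ∈ Icc J.fst J.snd, Icc J.fst J.snd ⊆ Metric.closedBall t (δ t) ∧
        η ≤ ‖mean F J - f t‖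
    · exact exists_fineSum_of_far F f hJ hη h
    · obtain ⟨v, hv⟩ := exists_fineSum F f hδ hJ
      have : farSet F f δ η 0 J = ∅ := by
        refine eq_empty_of_forall_notMem ?_
        rintro t ⟨ht, k, hk, h1, h2⟩
        obtain rfl := Nat.le_zero.1 hk
        exact h ⟨t, ht, h1, h2⟩
      refine ⟨v, hv, ?_⟩
      rw [this, measureReal_empty, mul_zero]
      exact hv.nonneg fun _ _ => norm_nonneg _
  | succ N ih =>
    by_cases h : ∃ t ∈ Icc J.fst J.snd, Icc J.fst J.snd ⊆ Metric.closedBall t (δ t) ∧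
        η ≤ ‖mean F J - f t‖
    · exact exists_fineSum_of_far F f hJ hη h
    · obtain ⟨v, hv, hv'⟩ := ih (J := leftHalf J) (by rw [len_leftHalf]; exact half_pos hJ)
      obtain ⟨w, hw, hw'⟩ := ih (J := rightHalf J) (by rw [len_rightHalf]; exact half_pos hJ)
      refine ⟨v + w, FineSum.split J v w hv hw, ?_⟩
      have hsub : farSet F f δ η (N + 1) J ⊆
          farSet F f δ η N (leftHalf J) ∪ farSet F f δ η N (rightHalf J) := by
        rintro t ⟨ht, k, hk, h1, h2⟩
        obtain _ | k := k
        · exact absurd ⟨t, ht, h1, h2⟩ h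
        · rw [cell_succ] at h1 h2
          by_cases hlt : t < mid J
          · rw [if_pos hlt] at h1 h2
            exact Or.inl ⟨⟨ht.1, hlt.le⟩, k, Nat.succ_le_succ_iff.1 hk, h1, h2⟩
          · rw [if_neg hlt] at h1 h2
            exact Or.inr ⟨⟨not_lt.1 hlt, ht.2⟩, k, Nat.succ_le_succ_iff.1 hk, h1, h2⟩
      calc η * (volume : Measure I).real (farSet F f δ η (N + 1) J)
          ≤ η * ((volume : Measure I).real (farSet F f δ η N (leftHalf J)) +
              (volume : Measure I).real (farSet F f δ η N (rightHalf J))) :=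
            mul_le_mul_of_nonneg_left
              ((measureReal_mono hsub).trans (measureReal_union_le _ _)) hη
        _ ≤ v + w := by rw [mul_add]; exact add_le_add hv' hw'

/-- The variational McShane condition for a function `f` and an interval function `F`. -/
def IsVariationalPrimitive : Prop :=
  ∀ ε > (0 : ℝ), ∃ δ : I → ℝ, (∀ t, 0 < δ t) ∧ ∀ P : McShanePartition, P.IsFine δ →
    ∑ k, ‖F (P.interval k) - len (P.interval k) • f (P.tag k)‖ < ε

namespace IsVariationalPrimitive

variable {F f}

theorem exists_fineSum_lt (h : IsVariationalPrimitive F f) {ε : ℝ} (hε : 0 < ε) :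
    ∃ δ : I → ℝ, (∀ t, 0 < δ t) ∧
      ∀ v, FineSum δ (fun K t => ‖F K - len K • f t‖) unitCell v → v < ε := by
  obtain ⟨δ, hδ0, hδ⟩ := h ε hε
  refine ⟨δ, hδ0, fun v hv => ?_⟩
  obtain ⟨P, hP, rfl⟩ := hv.exists_partition
  exact hδ P hP

theorem measure_frequently_far (h : IsVariationalPrimitive F f) {η : ℝ} (hη : 0 < η) :
    volume {t | ∃ᶠ n in atTop, η ≤ ‖mean F (cell n unitCell t) - f t‖} = 0 := by
  refine le_antisymm (ENNReal.le_of_forall_pos_le_add fun ε hε _ => ?_) zero_le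
  -- Sums below `η * ε` force each far set to have outer measure below `ε`.
  obtain ⟨δ, hδ0, hδ⟩ := h.exists_fineSum_lt (ε := η * ε) (by positivity)
  have hsub : {t | ∃ᶠ n in atTop, η ≤ ‖mean F (cell n unitCell t) - f t‖} ⊆
      ⋃ N, farSet F f δ η N unitCell := by
    intro t ht
    have hlim : Tendsto (fun n : ℕ => len (cell n unitCell t)) atTop (𝓝 0) := by
      simp only [len_cell, len_unitCell, one_div]
      simpa using tendsto_pow_atTop_nhds_zero_of_lt_one (r := (2 : ℝ)⁻¹) (by norm_num)
        (by norm_num)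
    obtain ⟨n, hn, hn'⟩ := (Frequently.and_eventually ht
      (hlim.eventually_le_const (hδ0 t))).exists
    exact mem_iUnion.2 ⟨n, mem_unitCell t, n, le_rfl,
      Icc_subset_closedBall (mem_cell n (mem_unitCell t)) hn', hn⟩
  rw [zero_add]
  refine (measure_mono hsub).trans ?_
  -- Continuity along increasing unions holds for arbitrary sets; this matters because `f` is not
  -- yet known to be measurable.
  rw [(farSet_mono F f δ η unitCell).measure_iUnion]
  refine iSup_le fun N => ?_
  obtain ⟨v, hv, hle⟩ := exists_fineSum_ge_measure_farSet F f hδ0 hη.le N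
    (J := unitCell) (by rw [len_unitCell]; exact one_pos)
  have := lt_of_mul_lt_mul_left (hle.trans_lt (hδ v hv)) hη.le
  rw [← ofReal_measureReal, ← ENNReal.ofReal_coe_nnreal]
  exact ENNReal.ofReal_le_ofReal this.le

theorem ae_tendsto_mean_cell (h : IsVariationalPrimitive F f) :
    ∀ᵐ t, Tendsto (fun n => mean F (cell n unitCell t)) atTop (𝓝 (f t)) := by
  have hall : ∀ᵐ t : I, ∀ m : ℕ, ¬ ∃ᶠ n in atTop,
      1 / ((m : ℝ) + 1) ≤ ‖mean F (cell n unitCell t) - f t‖ :=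
    ae_all_iff.2 fun m => by
      have := h.measure_frequently_far (Nat.one_div_pos_of_nat (α := ℝ) (n := m))
      rw [ae_iff]
      simpa only [not_not] using this
  filter_upwards [hall] with t ht
  rw [Metric.tendsto_nhds]
  intro ε hε
  obtain ⟨m, hm⟩ := exists_nat_one_div_lt hε
  filter_upwards [not_frequently.1 (ht m)] with n hn
  rw [dist_eq_norm]
  exact (not_le.1 hn).trans hm

/-- Dyadic means are step functions converging to `f` almost everywhere, with `L¹` norms eventually
at most `1 + R`; Fatou's lemma concludes. -/
theorem integrable (h : IsVariationalPrimitive F f) : Integrable f := by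
  have hlim := h.ae_tendsto_mean_cell
  have hmeas := fun n => stronglyMeasurable_comp_cell (mean F) n unitCell
  refine ⟨aestronglyMeasurable_of_tendsto_ae atTop
    (fun n => (hmeas n).aestronglyMeasurable) hlim, ?_⟩
  obtain ⟨δ, hδ0, hδ⟩ := h.exists_fineSum_lt one_pos
  obtain ⟨r, hr, R, hR, htag⟩ := exists_fine_tag f hδ0
  obtain ⟨n₀, hn₀⟩ := pow_unbounded_of_one_lt (1 / r) one_lt_two
  have hbound : ∀ n ≥ n₀, ∫⁻ t, ‖mean F (cell n unitCell t)‖ₑ ≤ ENNReal.ofReal (1 + R) := by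
    intro n hn
    have hle : len unitCell ≤ 2 ^ n * r := by
      rw [len_unitCell]
      exact (((div_lt_iff₀ hr).1 hn₀).le).trans (mul_le_mul_of_nonneg_right
        (pow_le_pow_right₀ one_le_two hn) hr.le)
    obtain ⟨v, hv, hv'⟩ := exists_fineSum_lintegral_le F f hR htag n
      (by rw [len_unitCell]; exact one_pos) hle
    rw [eq_univ_of_forall mem_unitCell, setLIntegral_univ, len_unitCell, mul_one] at hv'
    exact hv'.trans (ENNReal.ofReal_le_ofReal (add_le_add_left (hδ v hv).le R))
  calc ∫⁻ t, ‖f t‖ₑ = ∫⁻ t, liminf (fun n => ‖mean F (cell n unitCell t)‖ₑ) atTop := by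
        refine lintegral_congr_ae ?_
        filter_upwards [hlim] with t ht using ht.enorm.liminf_eq.symm
    _ ≤ liminf (fun n => ∫⁻ t, ‖mean F (cell n unitCell t)‖ₑ) atTop :=
        lintegral_liminf_le fun n => (hmeas n).enorm
    _ ≤ ENNReal.ofReal (1 + R) := by
        refine liminf_le_of_frequently_le' (Eventually.frequently ?_)
        filter_upwards [eventually_ge_atTop n₀] with n hn using hbound n hn
    _ < ∞ := ENNReal.ofReal_lt_top

end IsVariationalPrimitive

end Differentiation

/-! ### Return to multifunctions and the equivalences. -/

theorem VariationallyMcShaneIntegrable.integrable_radstrom {Γ : I → CB X}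
    (h : VariationallyMcShaneIntegrable Γ) :
    Integrable (fun t => radstrom (Γ t)) (volume : Measure I) := by
  obtain ⟨Φ, -, hΦ⟩ := h
  have : IsVariationalPrimitive (fun J => radstrom (Φ J)) fun t => radstrom (Γ t) := by
    intro ε hε
    obtain ⟨δ, hδ0, hδ⟩ := hΦ ε hε
    refine ⟨δ, hδ0, fun P hP => ?_⟩
    simpa only [hausdorffDist_smul (len_nonneg _)] using hδ P hP
  exact this.integrable

end MultiIntegral

end

theorem mainTheorem4 {X : Type*} [NormedAddCommGroup X] [NormedSpace ℝ X] [CompleteSpace X]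
    (Γ : I → MultiIntegral.CB X) (hΓ : MultiIntegral.ScalarlyMeasurable Γ) :
    List.TFAE
      [MultiIntegral.VariationallyMcShaneIntegrable Γ,
       Integrable (fun t => MultiIntegral.radstrom (Γ t)) volume,
       MultiIntegral.BochnerMeasurable Γ ∧ MultiIntegral.IntegrablyBounded Γ,
       MultiIntegral.BochnerMeasurable Γ ∧
         ∃ M : Set I → MultiIntegral.CB X,
           MultiIntegral.IsPettisIntegral Γ M ∧ MultiIntegral.variation M univ < ∞] := by
  tfae_have 1 → 2 := MultiIntegral.VariationallyMcShaneIntegrable.integrable_radstrom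
  tfae_have 2 → 1 := MultiIntegral.variationallyMcShaneIntegrable_of_integrable
  tfae_have 2 ↔ 3 := MultiIntegral.integrable_radstrom_iff
  tfae_have 2 ↔ 4 := MultiIntegral.integrable_radstrom_iff_pettis
  tfae_finish
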